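/- **Theorem (Hyperbolic regime).** Let $H$ be a real Hilbert space with norm $|\cdot|$, and let $A$ be a nonnegative self-adjoint (possibly unbounded) linear operator on $H$ with dense domain $D(A)$. Let $A^{1/2}$ denote its nonnegative self-adjoint square root. Let $m:[0,+\infty)\to[0,+\infty)$ be continuous, and let $b:[0,+\infty)\to(0,+\infty)$ be continuous with $$\int_0^{+\infty} b(s)\,ds<+\infty$$ (for $b(t)=(1+t)^{-p}$ this means $p>1$). Let $(u_0,u_1)\in D(A)\times D(A^{1/2})$ satisfy $$|u_1|^2+\int_0^{|A^{1/2}u_0|^2} m(\sigma)\,d\sigma>0 .$$ Assume that for some $\varepsilon>0$ the Cauchy problem $$\varepsilon u_\varepsilon''(t)+b(t)u_\varepsilon'(t)+m\big(|A^{1/2}u_\varepsilon(t)|^2\big)Au_\varepsilon(t)=0\quad(t\ge 0),\qquad u_\varepsilon(0)=u_0,\quad u_\varepsilon'(0)=u_1,$$ has a global solution $$u_\varepsilon\in C^2([0,+\infty);H)\cap C^1([0,+\infty);D(A^{1/2}))\cap C^0([0,+\infty);D(A)),$$ where $D(A^{1/2})$ and $D(A)$ carry their graph norms. Then $$\liminf_{t\to+\infty}\left(|u_\varepsilon'(t)|^2+|A^{1/2}u_\varepsilon(t)|^2\right)>0,$$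 where the liminf is taken in $[0,+\infty]$. -/

import Mathlib

open Set Filter Topology

/-- An (unbounded) linear operator `A` on a real Hilbert space is nonnegative when
`⟨Ax, x⟩ ≥ 0` for every `x` in its domain. -/
def IsNonnegOp {H : Type*} [NormedAddCommGroup H] [InnerProductSpace ℝ H]
    (A : H →ₗ.[ℝ] H) : Prop :=
  ∀ x : A.domain, 0 ≤ inner ℝ (A x) (x : H)

/-- `S` is a nonnegative self-adjoint square root of `A`: `S` is self-adjoint and nonnegative, and
`S ∘ S = A` as unbounded operators, that is, `D(A) = {x ∈ D(S) : S x ∈ D(S)}` and `A x = S (S x)`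
there. For `A` self-adjoint and nonnegative there is exactly one such `S`, written `A^{1/2}`. -/
structure IsNonnegSqrt {H : Type*} [NormedAddCommGroup H] [InnerProductSpace ℝ H]
    [CompleteSpace H] (A S : H →ₗ.[ℝ] H) : Prop where
  isSelfAdjoint : IsSelfAdjoint S
  isNonnegOp : IsNonnegOp S
  mem_domain_iff : ∀ x : H, x ∈ A.domain ↔ ∃ hx : x ∈ S.domain, S ⟨x, hx⟩ ∈ S.domain
  apply_eq : ∀ (x : A.domain) (y : S.domain) (z : S.domain),
    (y : H) = x → (z : H) = S y → A x = S z

namespace SqrtConstruction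

variable {H : Type*} [NormedAddCommGroup H] [InnerProductSpace ℝ H] [CompleteSpace H]

/-- Iteration `Y₀ = 0`, `Yₙ₊₁ = (X + Yₙ²)/2`, converging to `1 - (1 - X)^{1/2}`. -/
noncomputable def iter (X : H →L[ℝ] H) : ℕ → (H →L[ℝ] H)
  | 0 => 0
  | n + 1 => (1 / 2 : ℝ) • (X + iter X n * iter X n)

/-- The scalar majorant of `iter`. -/
noncomputable def siter : ℕ → ℝ
  | 0 => 0
  | n + 1 => (1 / 2 : ℝ) * (1 + siter n * siter n)

theorem siter_bounds (n : ℕ) : 0 ≤ siter n ∧ siter n ≤ 1 ∧ siter n ≤ siter (n + 1) := by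
  have h : 0 ≤ siter n ∧ siter n ≤ 1 := by
    induction n with
    | zero => simp [siter]
    | succ n ih =>
      simp only [siter]
      constructor <;> nlinarith [ih.1, ih.2]
  refine ⟨h.1, h.2, ?_⟩
  simp only [siter]
  nlinarith [sq_nonneg (siter n - 1)]

theorem norm_iter_le (X : H →L[ℝ] H) (hX : ‖X‖ ≤ 1) (n : ℕ) : ‖iter X n‖ ≤ siter n := by
  induction n with
  | zero => simp [iter, siter]
  | succ n ih =>
    simp only [iter, siter]
    rw [norm_smul]
    have h1 : ‖X + iter X n * iter X n‖ ≤ 1 + siter n * siter n := by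
      refine (norm_add_le _ _).trans (add_le_add hX ((norm_mul_le _ _).trans ?_))
      exact mul_le_mul ih ih (norm_nonneg _) (siter_bounds n).1
    have h2 : ‖(1 / 2 : ℝ)‖ = 1 / 2 := by norm_num
    rw [h2]
    linarith

theorem norm_iter_sub_le (X : H →L[ℝ] H) (hX : ‖X‖ ≤ 1) (n : ℕ) :
    ‖iter X (n + 1) - iter X n‖ ≤ siter (n + 1) - siter n := by
  induction n with
  | zero =>
    have := norm_iter_le X hX 1
    simpa [iter, siter] using this
  | succ n ih =>
    have e : iter X (n + 1 + 1) - iter X (n + 1) =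
        (1 / 2 : ℝ) • (iter X (n + 1) * (iter X (n + 1) - iter X n) +
          (iter X (n + 1) - iter X n) * iter X n) := by
      conv_lhs => rw [iter]
      conv_lhs => arg 2; rw [iter]
      rw [← smul_sub]
      congr 1
      noncomm_ring
    have e' : siter (n + 1 + 1) - siter (n + 1) =
        (1 / 2 : ℝ) * (siter (n + 1) * (siter (n + 1) - siter n) +
          (siter (n + 1) - siter n) * siter n) := by
      conv_lhs => rw [siter]
      conv_lhs => arg 2; rw [siter]
      ring
    rw [e, e', norm_smul]
    have h2 : ‖(1 / 2 : ℝ)‖ = 1 / 2 := by norm_num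
    rw [h2]
    refine mul_le_mul_of_nonneg_left ((norm_add_le _ _).trans (add_le_add ?_ ?_)) (by norm_num)
    · exact (norm_mul_le _ _).trans
        (mul_le_mul (norm_iter_le X hX _) ih (norm_nonneg _) (siter_bounds _).1)
    · exact (norm_mul_le _ _).trans
        (mul_le_mul ih (norm_iter_le X hX _) (norm_nonneg _)
          (by linarith [(siter_bounds n).2.2]))

theorem exists_tendsto_iter (X : H →L[ℝ] H) (hX : ‖X‖ ≤ 1) :
    ∃ Y, Tendsto (iter X) atTop (𝓝 Y) := by
  apply cauchySeq_tendsto_of_complete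
  refine cauchySeq_of_summable_dist ?_
  refine Summable.of_nonneg_of_le (f := fun n => siter (n + 1) - siter n)
    (fun _ => dist_nonneg) (fun n => ?_) ?_
  · rw [dist_comm, dist_eq_norm]
    exact norm_iter_sub_le X hX n
  · refine summable_of_sum_range_le (c := 1)
      (fun n => by linarith [(siter_bounds n).2.2]) (fun n => ?_)
    rw [Finset.sum_range_sub]
    have := (siter_bounds n).2.1
    simpa [siter] using this

/-- Square roots of bounded operators `1 - X` with `X` symmetric and `‖X‖ ≤ 1`. -/
theorem exists_bounded_sqrt (X : H →L[ℝ] H) (hX : ‖X‖ ≤ 1)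
    (hs : ∀ x y, inner ℝ (X x) y = inner ℝ x (X y)) :
    ∃ R : H →L[ℝ] H, R * R = 1 - X ∧ ‖1 - R‖ ≤ 1 ∧
      (∀ x y, inner ℝ (R x) y = inner ℝ x (R y)) ∧
      ∀ B : H →L[ℝ] H, B * X = X * B → B * R = R * B := by
  obtain ⟨Y, hY⟩ := exists_tendsto_iter X hX
  have hlim : Y = (1 / 2 : ℝ) • (X + Y * Y) := by
    refine tendsto_nhds_unique ((tendsto_add_atTop_iff_nat 1).2 hY) ?_
    exact ((tendsto_const_nhds (x := X)).add (hY.mul hY)).const_smul (1 / 2 : ℝ)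
  have h2 : X = Y + Y - Y * Y := by
    have : (2 : ℝ) • Y = X + Y * Y := by
      conv_lhs => rw [hlim]
      rw [smul_smul]; norm_num
    rw [two_smul] at this
    rw [this]; abel
  have hsym : ∀ n x y, inner ℝ (iter X n x) y = inner ℝ x (iter X n y) := by
    intro n
    induction n with
    | zero => intro x y; simp [iter]
    | succ n ih =>
      intro x y
      simp [iter, inner_smul_left, inner_smul_right, inner_add_left, inner_add_right, hs, ih]
  have hcomm : ∀ B : H →L[ℝ] H, B * X = X * B → ∀ n, B * iter X n = iter X n * B := by
    intro B hB n
    induction n with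
    | zero => simp [iter]
    | succ n ih =>
      simp only [iter, mul_smul_comm, smul_mul_assoc, mul_add, add_mul, hB]
      rw [← mul_assoc, ih, mul_assoc, ih, mul_assoc]
  refine ⟨1 - Y, ?_, ?_, ?_, ?_⟩
  · rw [h2]; noncomm_ring
  · rw [sub_sub_cancel]
    exact le_of_tendsto hY.norm
      (Eventually.of_forall fun n => (norm_iter_le X hX n).trans (siter_bounds n).2.1)
  · intro x y
    have hx : ∀ x, Tendsto (fun n => iter X n x) atTop (𝓝 (Y x)) := fun x =>
      ((ContinuousLinearMap.apply ℝ H x).continuous.tendsto Y).comp hY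
    have : inner ℝ (Y x) y = inner ℝ x (Y y) := by
      refine tendsto_nhds_unique ((hx x).inner tendsto_const_nhds) ?_
      simp_rw [hsym]
      exact tendsto_const_nhds.inner (hx y)
    simp [inner_sub_left, inner_sub_right, this]
  · intro B hB
    have : B * Y = Y * B := by
      refine tendsto_nhds_unique (hY.const_mul B) ?_
      simp_rw [hcomm B hB]
      exact hY.mul_const B
    rw [mul_sub, sub_mul, this]; simp

theorem inner_nonneg_of_norm (R : H →L[ℝ] H) (h : ‖1 - R‖ ≤ 1) (x : H) :
    0 ≤ inner ℝ (R x) x := by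
  have h1 : inner ℝ ((1 - R) x) x ≤ ‖x‖ * ‖x‖ :=
    (real_inner_le_norm _ _).trans (mul_le_mul_of_nonneg_right
      (by simpa using (1 - R).le_of_opNorm_le h x) (norm_nonneg _))
  simp only [sub_apply, inner_sub_left,
    one_apply_eq_self, real_inner_self_eq_norm_mul_norm] at h1
  linarith

theorem symm_of_isSelfAdjoint {A : H →ₗ.[ℝ] H} (hA : IsSelfAdjoint A) (x y : A.domain) :
    inner ℝ (A x) (y : H) = inner ℝ (x : H) (A y) := by
  have h := A.adjoint_isFormalAdjoint hA.dense_domain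
  rw [LinearPMap.isSelfAdjoint_def.1 hA] at h
  exact h x y

/-- The resolvent `T = (1 + A)⁻¹`. -/
theorem exists_resolvent {A : H →ₗ.[ℝ] H} (hA : IsSelfAdjoint A) (hpos : IsNonnegOp A) :
    ∃ T : H →L[ℝ] H, ‖1 - T‖ ≤ 1 ∧ ‖T‖ ≤ 1 ∧
      (∀ x y, inner ℝ (T x) y = inner ℝ x (T y)) ∧
      (∀ y, ∃ h : T y ∈ A.domain, A ⟨T y, h⟩ = y - T y) ∧
      ∀ x : A.domain, T (x + A x) = x := by
  have key : ∀ x : A.domain, ‖(x : H)‖ ≤ ‖(x : H) + A x‖ ∧ ‖A x‖ ≤ ‖(x : H) + A x‖ := by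
    intro x
    have h := hpos x
    rw [real_inner_comm] at h
    have e := norm_add_sq_real (x : H) (A x)
    constructor <;> refine abs_le_of_sq_le_sq' ?_ (norm_nonneg _) |>.2 <;>
      nlinarith [sq_nonneg ‖(x : H)‖, sq_nonneg ‖A x‖]
  have hcl : IsClosed (A.graph : Set (H × H)) := hA.isClosed
  have hgr : CompleteSpace A.graph := hcl.completeSpace_coe
  have hdiff : ∀ p : A.graph, ∃ x : A.domain, (x : H) = (p : H × H).1 ∧ A x = (p : H × H).2 := by
    rintro ⟨p, hp⟩
    obtain ⟨x, h1, h2⟩ := (A.mem_graph_iff).1 hp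
    exact ⟨x, h1, h2⟩
  let g : A.graph →L[ℝ] H :=
    (ContinuousLinearMap.fst ℝ H H + ContinuousLinearMap.snd ℝ H H).comp A.graph.subtypeL
  have hg : ∀ p : A.graph, g p = (p : H × H).1 + (p : H × H).2 := fun p => rfl
  have hbd : ∀ p : A.graph, ‖p‖ ≤ ‖g p‖ := by
    intro p
    obtain ⟨x, h1, h2⟩ := hdiff p
    rw [hg, ← h1, ← h2, Submodule.coe_norm, Prod.norm_def, ← h1, ← h2]
    exact max_le (key x).1 (key x).2
  have hanti : AntilipschitzWith 1 g := by
    refine g.antilipschitz_of_bound (fun p => ?_)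
    simpa using hbd p
  have hrc : IsClosed (Set.range g) := hanti.isClosed_range g.uniformContinuous
  have hrange : LinearMap.range g.toLinearMap = ⊤ := by
    have hcl' : IsClosed ((LinearMap.range g.toLinearMap : Submodule ℝ H) : Set H) := by
      exact hrc
    have := hcl'.completeSpace_coe
    rw [← Submodule.orthogonal_eq_bot_iff, Submodule.eq_bot_iff]
    intro y hy
    have hy' : ∀ x : A.domain, inner ℝ (-y) (x : H) = inner ℝ y (A x) := by
      intro x
      have := hy ((x : H) + A x) ⟨⟨(x, A x), A.mem_graph x⟩, rfl⟩
      rw [real_inner_comm, inner_add_right] at this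
      rw [inner_neg_left]; linarith
    have hmem : y ∈ A.adjoint.domain := A.mem_adjoint_domain_of_exists y ⟨-y, hy'⟩
    have hval : A.adjoint ⟨y, hmem⟩ = -y := A.adjoint_apply_eq hA.dense_domain ⟨y, hmem⟩ hy'
    have hmemA : y ∈ A.domain := by
      have := hmem; rwa [LinearPMap.isSelfAdjoint_def.1 hA] at this
    have hvalA : A ⟨y, hmemA⟩ = -y := by
      rw [← hval]
      exact ((le_of_eq (LinearPMap.isSelfAdjoint_def.1 hA).symm).2 (x := ⟨y, hmemA⟩) (y := ⟨y, hmem⟩) rfl)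
    have := hpos ⟨y, hmemA⟩
    rw [hvalA, inner_neg_left] at this
    have h0 : inner ℝ y y ≤ 0 := by linarith
    exact inner_self_eq_zero.1 (le_antisymm h0 real_inner_self_nonneg)
  let e : A.graph ≃ₗ[ℝ] H := LinearEquiv.ofBijective g.toLinearMap
    ⟨hanti.injective, LinearMap.range_eq_top.1 hrange⟩
  have he : ∀ y, g (e.symm y) = y := fun y => e.apply_symm_apply y
  let T : H →L[ℝ] H := LinearMap.mkContinuous
    ((LinearMap.fst ℝ H H).comp (A.graph.subtype.comp e.symm.toLinearMap)) 1 (fun y => by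
      have h1 := hbd (e.symm y)
      rw [he] at h1
      rw [one_mul]
      exact (norm_fst_le (e.symm y : H × H)).trans h1)
  have hT : ∀ y, T y = (e.symm y : H × H).1 := fun y => rfl
  have hTA : ∀ y, ∃ h : T y ∈ A.domain, A ⟨T y, h⟩ = y - T y := by
    intro y
    obtain ⟨x, h1, h2⟩ := hdiff (e.symm y)
    have h3 := he y
    rw [hg, ← h1, ← h2] at h3
    rw [hT, ← h1]
    exact ⟨x.2, by rw [← h3]; simp⟩
  refine ⟨T, ?_, ?_, ?_, hTA, ?_⟩
  · refine ContinuousLinearMap.opNorm_le_bound _ zero_le_one (fun y => ?_)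
    obtain ⟨h, h'⟩ := hTA y
    have := (key ⟨T y, h⟩).2
    rw [h'] at this
    simpa using this
  · exact LinearMap.mkContinuous_norm_le _ zero_le_one _
  · intro x y
    obtain ⟨hx, hx'⟩ := hTA x
    obtain ⟨hy, hy'⟩ := hTA y
    have := symm_of_isSelfAdjoint hA ⟨T x, hx⟩ ⟨T y, hy⟩
    rw [hx', hy'] at this
    simp only [inner_sub_left, inner_sub_right] at this
    linarith
  · intro x
    have : e.symm ((x : H) + A x) = ⟨(x, A x), A.mem_graph x⟩ := by
      rw [LinearEquiv.symm_apply_eq]; rfl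
    rw [hT, this]

/-- Every nonnegative self-adjoint operator has a nonnegative self-adjoint square root. -/
theorem exists_isNonnegSqrt {A : H →ₗ.[ℝ] H} (hA : IsSelfAdjoint A) (hpos : IsNonnegOp A) :
    ∃ S : H →ₗ.[ℝ] H, IsNonnegSqrt A S := by
  obtain ⟨T, hT1, hT2, hTs, hTA, hAT⟩ := exists_resolvent hA hpos
  obtain ⟨R, hRR, hR1, hRs, hRc⟩ := exists_bounded_sqrt (1 - T) hT1
    (fun x y => by simp [inner_sub_left, inner_sub_right, hTs])
  obtain ⟨Q, hQQ, hQ1, hQs, hQc⟩ := exists_bounded_sqrt T hT2 hTs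
  rw [sub_sub_cancel] at hRR
  have hQR : R * Q = Q * R := hQc R (by rw [← hRR, mul_assoc])
  obtain ⟨P, hPP, hP1, hPs, hPc⟩ := exists_bounded_sqrt (1 - R) hR1
    (fun x y => by simp [inner_sub_left, inner_sub_right, hRs])
  rw [sub_sub_cancel] at hPP
  have hPQ : Q * P = P * Q := hPc Q (by rw [mul_sub, sub_mul, hQR]; simp)
  have aRR : ∀ x, R (R x) = T x := fun x => by rw [← hRR]; rfl
  have aQQ : ∀ x, Q (Q x) = x - T x := fun x => by
    have := congrArg (fun B : H →L[ℝ] H => B x) hQQ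
    simpa using this
  have aQR : ∀ x, R (Q x) = Q (R x) := fun x => congrArg (fun B : H →L[ℝ] H => B x) hQR
  have aPQ : ∀ x, Q (P x) = P (Q x) := fun x => congrArg (fun B : H →L[ℝ] H => B x) hPQ
  have aPP : ∀ x, P (P x) = R x := fun x => by rw [← hPP]; rfl
  have hTinj : ∀ y, T y = 0 → y = 0 := by
    intro y hy
    obtain ⟨h, h'⟩ := hTA y
    have h0 : (⟨T y, h⟩ : A.domain) = 0 := Subtype.ext hy
    rw [h0, LinearPMap.map_zero, hy, sub_zero] at h'
    exact h'.symm
  have hRinj : Function.Injective R := by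
    refine (injective_iff_map_eq_zero R).2 (fun y hy => hTinj y ?_)
    rw [← aRR, hy, map_zero]
  let e : H ≃ₗ[ℝ] LinearMap.range R.toLinearMap := LinearEquiv.ofInjective R.toLinearMap hRinj
  let S : H →ₗ.[ℝ] H := ⟨LinearMap.range R.toLinearMap, Q.toLinearMap.comp e.symm.toLinearMap⟩
  have hdom : ∀ x, x ∈ S.domain ↔ ∃ y, R y = x := fun x => Iff.rfl
  have hS : ∀ (x : S.domain) (y : H), R y = x → S x = Q y := by
    intro x y hy
    have : e.symm x = y := by
      rw [LinearEquiv.symm_apply_eq]; exact Subtype.ext hy.symm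
    change Q (e.symm x) = Q y
    rw [this]
  have hdense : Dense (S.domain : Set H) := by
    rw [Submodule.dense_iff_topologicalClosure_eq_top,
      Submodule.topologicalClosure_eq_top_iff, Submodule.eq_bot_iff]
    intro y hy
    have h1 : inner ℝ (R (R y)) y = 0 := hy (R (R y)) ⟨R y, rfl⟩
    rw [hRs] at h1
    have h2 : R y = 0 := inner_self_eq_zero.1 h1
    exact hRinj (by rw [h2, map_zero])
  have hsymm : S.IsFormalAdjoint S := by
    intro x y
    obtain ⟨a, ha⟩ := (hdom x).1 x.2
    obtain ⟨c, hc⟩ := (hdom y).1 y.2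
    rw [hS x a ha, hS y c hc, ← ha, ← hc, ← hRs, aQR, hQs]
  have hsa : IsSelfAdjoint S := by
    rw [LinearPMap.isSelfAdjoint_def]
    symm
    refine LinearPMap.eq_of_le_of_domain_eq (hsymm.le_adjoint hdense) ?_
    refine le_antisymm (hsymm.le_adjoint hdense).1 (fun v hv => ?_)
    have hf := S.adjoint_isFormalAdjoint hdense ⟨v, hv⟩
    set w := S.adjoint ⟨v, hv⟩ with hw
    have h1 : Q v = R w := by
      refine ext_inner_right ℝ (fun y => ?_)
      have := hf ⟨R y, y, rfl⟩
      rw [hS ⟨R y, y, rfl⟩ y rfl] at this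
      rw [hQs, hRs]
      exact this.symm
    refine (hdom v).2 ⟨R v + Q w, ?_⟩
    rw [map_add, aRR, aQR, ← h1, aQQ]
    abel
  refine ⟨S, hsa, ?_, ?_, ?_⟩
  · intro x
    obtain ⟨a, ha⟩ := (hdom x).1 x.2
    rw [hS x a ha, ← ha, ← aPP, ← hPs, ← aPQ]
    exact inner_nonneg_of_norm Q hQ1 _
  · intro x
    constructor
    · intro hx
      have h1 := hAT ⟨x, hx⟩
      set y := (x : H) + A ⟨x, hx⟩ with hy
      have hm : R (R y) = x := by rw [aRR]; exact h1
      have hx' : x ∈ S.domain := (hdom x).2 ⟨R y, hm⟩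
      refine ⟨hx', ?_⟩
      rw [hS ⟨x, hx'⟩ (R y) hm, ← aQR]
      exact ⟨Q y, rfl⟩
    · rintro ⟨hx1, hx2⟩
      obtain ⟨z, hz'⟩ := (hdom x).1 hx1
      rw [hS ⟨x, hx1⟩ z hz'] at hx2
      obtain ⟨w, hw⟩ := (hdom _).1 hx2
      have e1 : z = R (R z + Q w) := by
        rw [map_add, aRR, aQR, hw, aQQ]; abel
      have e2 : x = T (R z + Q w) := by rw [← aRR, ← e1, hz']
      rw [e2]
      exact (hTA _).1
  · intro x y z hy hz
    have h1 := hAT x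
    set v := (x : H) + A x with hv
    have hm : R (R v) = y := by rw [aRR, h1, hy]
    have h2 : R (Q v) = z := by rw [hz, hS y (R v) hm, aQR]
    rw [hS z (Q v) h2, aQQ, h1, hv]
    abel

end SqrtConstruction

/-- The nonnegative self-adjoint square root `A^{1/2}` of a nonnegative self-adjoint operator. -/
noncomputable def opSqrt {H : Type*} [NormedAddCommGroup H] [InnerProductSpace ℝ H]
    [CompleteSpace H] (A : H →ₗ.[ℝ] H) (hA : IsSelfAdjoint A) (hpos : IsNonnegOp A) :
    H →ₗ.[ℝ] H :=
  (SqrtConstruction.exists_isNonnegSqrt hA hpos).choose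

theorem opSqrt_spec {H : Type*} [NormedAddCommGroup H] [InnerProductSpace ℝ H]
    [CompleteSpace H] (A : H →ₗ.[ℝ] H) (hA : IsSelfAdjoint A) (hpos : IsNonnegOp A) :
    IsNonnegSqrt A (opSqrt A hA hpos) :=
  (SqrtConstruction.exists_isNonnegSqrt hA hpos).choose_spec

open Classical in
/-- The value `B x`, for `x` in the domain of `B`; the value `0` outside the domain is never
used: wherever the theorem applies `B`, membership in the domain is part of its hypotheses. -/
noncomputable def opVal {H : Type*} [NormedAddCommGroup H] [InnerProductSpace ℝ H]
    (B : H →ₗ.[ℝ] H) (x : H) : H :=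
  if h : x ∈ B.domain then B ⟨x, h⟩ else 0

/-- `u ∈ C^k([0,∞); D(B))`, where `D(B)` carries the graph norm. The normed space `D(B)` is
realized as the graph `{(x, B x) : x ∈ D(B)} ⊆ H × H`, whose norm `max(|x|, |B x|)` is equivalent
to `(|x|² + |B x|²)^{1/2}`. In particular `u t ∈ D(B)` for every `t ≥ 0`. -/
def IsCkDomainCurve {H : Type*} [NormedAddCommGroup H] [InnerProductSpace ℝ H]
    (k : ℕ) (B : H →ₗ.[ℝ] H) (u : ℝ → H) : Prop :=
  ∃ U : ℝ → B.graph, ContDiffOn ℝ k U (Ici 0) ∧ ∀ t ∈ Ici (0 : ℝ), (U t : H × H).1 = u t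

/-- `u : [0,∞) → H` is a global solution, in the class
`C²([0,∞);H) ∩ C¹([0,∞);D(A^{1/2})) ∩ C⁰([0,∞);D(A))`, of
`ε u'' + b(t) u' + m(|A^{1/2}u|²) A u = 0`, `u(0) = u₀`, `u'(0) = u₁`.
Only the values of `u`, `b`, `m` on `[0,∞)` matter; derivatives at `t = 0` are one-sided. -/
structure IsGlobalKirchhoffSolution {H : Type*} [NormedAddCommGroup H] [InnerProductSpace ℝ H]
    [CompleteSpace H] (A : H →ₗ.[ℝ] H) (hA : IsSelfAdjoint A) (hpos : IsNonnegOp A)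
    (m b : ℝ → ℝ) (ε : ℝ) (u₀ u₁ : H) (u : ℝ → H) : Prop where
  contDiffOn : ContDiffOn ℝ 2 u (Ici 0)
  curve_sqrt : IsCkDomainCurve 1 (opSqrt A hA hpos) u
  curve_op : IsCkDomainCurve 0 A u
  equation : ∀ t ∈ Ici (0 : ℝ),
    ε • derivWithin (derivWithin u (Ici 0)) (Ici 0) t + b t • derivWithin u (Ici 0) t
      + m (‖opVal (opSqrt A hA hpos) (u t)‖ ^ 2) • opVal A (u t) = 0
  initial_value : u 0 = u₀
  initial_velocity : derivWithin u (Ici 0) 0 = u₁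

/-! Pairing the equation with `u'` shows that the energy E = ε|u'|² + M(|A^{1/2}u|²), with M(x) =
∫₀ˣ m, satisfies E' = -2b|u'|². Since M ≥ 0 on the half line, ε|u'|² ≤ E, so E' ≥ -(2/ε) b E.
Because b is integrable, the total dissipation can shrink E by at most the factor exp(-(2/ε)∫b), and
E(0) > 0 by the assumption on the data. Hence E stays above some c > 0. Conversely M is continuous
with M(0) = 0, so E would be less than c whenever |u'|² + |A^{1/2}u|² is small; that sum is
therefore bounded below for all t ≥ 0.

The analytic core is `mul_exp_neg_integral_le` (Gronwall) and
`IsGlobalKirchhoffSolution.exists_pos_le_energy`. The chain rule for |A^{1/2}u|² rests on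
`IsCkDomainCurve.hasDerivAt_opVal` and `IsNonnegSqrt.inner_opVal`. -/

/-! ### Curves with values in the domain of an unbounded operator -/

section DomainCurve

variable {H : Type*} [NormedAddCommGroup H] [InnerProductSpace ℝ H]

theorem opVal_of_mem {B : H →ₗ.[ℝ] H} {x : H} (h : x ∈ B.domain) : opVal B x = B ⟨x, h⟩ :=
  dif_pos h

theorem mem_domain_of_mem_graph {B : H →ₗ.[ℝ] H} {p : H × H} (hp : p ∈ B.graph) :
    p.1 ∈ B.domain ∧ opVal B p.1 = p.2 := by
  obtain ⟨x, h1, h2⟩ := B.mem_graph_iff.1 hp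
  have hx : p.1 ∈ B.domain := h1 ▸ x.2
  refine ⟨hx, ?_⟩
  rw [opVal_of_mem hx, ← h2]
  congr 1
  exact Subtype.ext h1.symm

theorem IsCkDomainCurve.mem_domain {k : ℕ} {B : H →ₗ.[ℝ] H} {u : ℝ → H}
    (h : IsCkDomainCurve k B u) {t : ℝ} (ht : 0 ≤ t) : u t ∈ B.domain := by
  obtain ⟨U, -, hU⟩ := h
  rw [← hU t ht]
  exact (mem_domain_of_mem_graph (U t).2).1

theorem IsCkDomainCurve.contDiffOn_opVal {k : ℕ} {B : H →ₗ.[ℝ] H} {u : ℝ → H}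
    (h : IsCkDomainCurve k B u) : ContDiffOn ℝ k (fun t => opVal B (u t)) (Ici 0) := by
  obtain ⟨U, hC, hU⟩ := h
  refine ContDiffOn.congr
    (((ContinuousLinearMap.snd ℝ H H).comp B.graph.subtypeL).contDiff.comp_contDiffOn hC) ?_
  intro t ht
  rw [← hU t ht]
  exact (mem_domain_of_mem_graph (U t).2).2

/-- A curve which is `C¹` with values in `D(B)` has its derivative in `D(B)`, and `B` commutes
with differentiation. -/
theorem IsCkDomainCurve.hasDerivAt_opVal {B : H →ₗ.[ℝ] H} {u : ℝ → H}
    (h : IsCkDomainCurve 1 B u) {t : ℝ} (ht : 0 < t) {v : H} (hv : HasDerivAt u v t) :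
    v ∈ B.domain ∧ HasDerivAt (fun t => opVal B (u t)) (opVal B v) t := by
  obtain ⟨U, hC, hU⟩ := h
  have hnhds : Ici (0 : ℝ) ∈ 𝓝 t := Ici_mem_nhds ht
  -- The derivative of `U` is taken in the normed space `B.graph`, so it is again a pair (x, B x);
  -- its two components then give both claims, with no appeal to closedness of `B`.
  have hd : HasDerivAt U (deriv U t) t :=
    ((hC.differentiableOn (by simp)).differentiableAt hnhds).hasDerivAt
  have h1 : HasDerivAt (fun s => (U s : H × H).1) ((deriv U t : B.graph) : H × H).1 t :=
    (((ContinuousLinearMap.fst ℝ H H).comp B.graph.subtypeL).hasFDerivAt).comp_hasDerivAt t hd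
  have h2 : HasDerivAt (fun s => (U s : H × H).2) ((deriv U t : B.graph) : H × H).2 t :=
    (((ContinuousLinearMap.snd ℝ H H).comp B.graph.subtypeL).hasFDerivAt).comp_hasDerivAt t hd
  have heq : u =ᶠ[𝓝 t] fun s => (U s : H × H).1 := by
    filter_upwards [hnhds] with s hs using (hU s hs).symm
  have hv' : v = ((deriv U t : B.graph) : H × H).1 := hv.unique (h1.congr_of_eventuallyEq heq)
  obtain ⟨hm, hval⟩ := mem_domain_of_mem_graph (deriv U t).2
  rw [hv']
  refine ⟨hm, ?_⟩
  rw [hval]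
  refine h2.congr_of_eventuallyEq ?_
  filter_upwards [hnhds] with s hs
  rw [← hU s hs]
  exact (mem_domain_of_mem_graph (U s).2).2

/-- `⟨A^{1/2}x, A^{1/2}y⟩ = ⟨Ax, y⟩` for `x ∈ D(A)` and `y ∈ D(A^{1/2})`. -/
theorem IsNonnegSqrt.inner_opVal [CompleteSpace H] {A S : H →ₗ.[ℝ] H} (h : IsNonnegSqrt A S)
    {x y : H} (hx : x ∈ A.domain) (hy : y ∈ S.domain) :
    inner ℝ (opVal S x) (opVal S y) = inner ℝ (opVal A x) y := by
  -- Since x lies in D(A), S x lies in D(S) again, so symmetry of S applies to the pair S x, y.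
  obtain ⟨hxS, hSx⟩ := (h.mem_domain_iff x).1 hx
  rw [opVal_of_mem hxS, opVal_of_mem hy, opVal_of_mem hx,
    h.apply_eq ⟨x, hx⟩ ⟨x, hxS⟩ ⟨_, hSx⟩ rfl rfl]
  exact (SqrtConstruction.symm_of_isSelfAdjoint h.isSelfAdjoint ⟨_, hSx⟩ ⟨y, hy⟩).symm

end DomainCurve

/-! ### Half-line integrals and Gronwall -/

section HalfLine

/-- Freezing the function at its value at 0 on the negative axis makes its primitive differentiable
on all of ℝ, including at 0, without changing integrals over [0, x]. -/
theorem ContinuousOn.continuous_comp_max {f : ℝ → ℝ} (hf : ContinuousOn f (Ici 0)) :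
    Continuous fun x => f (max x 0) :=
  hf.comp_continuous (continuous_id.max continuous_const) fun x => le_max_right x 0

theorem intervalIntegral_comp_max (f : ℝ → ℝ) {x : ℝ} (hx : 0 ≤ x) :
    ∫ σ in (0 : ℝ)..x, f (max σ 0) = ∫ σ in (0 : ℝ)..x, f σ := by
  refine intervalIntegral.integral_congr fun σ hσ => ?_
  rw [uIcc_of_le hx] at hσ
  simp [max_eq_left hσ.1]

/-- Backward Gronwall inequality: if `E ≥ 0` and `E' ≥ -k b E` with `b` integrable on the half
line, then `E` stays above a positive multiple of `E 0`. -/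
theorem mul_exp_neg_integral_le {E E' b : ℝ → ℝ} {k : ℝ} (hk : 0 ≤ k)
    (hE : ContinuousOn E (Ici 0)) (hE0 : 0 ≤ E 0) (hE' : ∀ t, 0 < t → HasDerivAt E (E' t) t)
    (hb : ContinuousOn b (Ici 0)) (hb_nonneg : ∀ t ∈ Ici (0 : ℝ), 0 ≤ b t)
    (hb_int : MeasureTheory.IntegrableOn b (Ici 0))
    (hle : ∀ t, 0 < t → -(k * b t * E t) ≤ E' t) {t : ℝ} (ht : 0 ≤ t) :
    E 0 * Real.exp (-(k * ∫ s in Ici (0 : ℝ), b s)) ≤ E t := by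
  have hbc := hb.continuous_comp_max
  set β : ℝ → ℝ := fun t => ∫ s in (0 : ℝ)..t, b (max s 0) with hβ
  have hβd : ∀ t, HasDerivAt β (b (max t 0)) t := fun t => hbc.integral_hasStrictDerivAt 0 t |>.hasDerivAt
  have hexp : ∀ t, HasDerivAt (fun t => Real.exp (k * β t))
      (Real.exp (k * β t) * (k * b (max t 0))) t := fun t => ((hβd t).const_mul k).exp
  -- Integrating factor: the derivative of the product is (E' + k b E) exp(kβ), which is
  -- nonnegative.
  have hmono : MonotoneOn (fun t => E t * Real.exp (k * β t)) (Ici 0) := by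
    refine monotoneOn_of_hasDerivWithinAt_nonneg (convex_Ici 0)
      (hE.mul fun t _ => (hexp t).continuousAt.continuousWithinAt)
      (f' := fun t => E' t * Real.exp (k * β t)
        + E t * (Real.exp (k * β t) * (k * b (max t 0)))) ?_ ?_
    · intro t ht
      rw [interior_Ici] at ht
      exact ((hE' t ht).mul (hexp t)).hasDerivWithinAt
    · intro t ht
      rw [interior_Ici] at ht
      have h1 := hle t ht
      rw [max_eq_left (le_of_lt ht)]
      have : 0 ≤ (E' t + k * b t * E t) * Real.exp (k * β t) :=
        mul_nonneg (by linarith) (Real.exp_pos _).le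
      linarith
  have h0 := hmono self_mem_Ici ht ht
  have hβ0 : β 0 = 0 := intervalIntegral.integral_same
  simp only [hβ0, mul_zero, Real.exp_zero, mul_one] at h0
  have hβle : β t ≤ ∫ s in Ici (0 : ℝ), b s := by
    rw [hβ]
    simp only
    rw [intervalIntegral_comp_max b ht, intervalIntegral.integral_of_le ht]
    refine MeasureTheory.setIntegral_mono_set hb_int ?_ ?_
    · exact (MeasureTheory.ae_restrict_iff' measurableSet_Ici).2 (Eventually.of_forall hb_nonneg)
    · exact (Ioc_subset_Icc_self.trans Icc_subset_Ici_self).eventuallyLE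
  calc E 0 * Real.exp (-(k * ∫ s in Ici (0 : ℝ), b s))
      ≤ E 0 * Real.exp (-(k * β t)) := by gcongr
    _ ≤ E t * Real.exp (k * β t) * Real.exp (-(k * β t)) := by gcongr
    _ = E t := by rw [mul_assoc, ← Real.exp_add, add_neg_cancel, Real.exp_zero, mul_one]

theorem intervalIntegral_nonneg_of_Ici {m : ℝ → ℝ} (hm : ∀ σ ∈ Ici (0 : ℝ), 0 ≤ m σ) {x : ℝ}
    (hx : 0 ≤ x) : 0 ≤ ∫ σ in (0 : ℝ)..x, m σ :=
  intervalIntegral.integral_nonneg hx fun σ hσ => hm σ hσ.1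

end HalfLine

/-! ### Energy estimate and conclusion -/

/-- The energy `ε|u'|² + ∫₀^{|A^{1/2}u|²} m` of a solution on a half line with integrable
dissipation coefficient stays above a positive constant. -/
theorem IsGlobalKirchhoffSolution.exists_pos_le_energy
    {H : Type*} [NormedAddCommGroup H] [InnerProductSpace ℝ H] [CompleteSpace H]
    {A : H →ₗ.[ℝ] H} {hA : IsSelfAdjoint A} {hpos : IsNonnegOp A} {m b : ℝ → ℝ} {ε : ℝ}
    {u₀ u₁ : H} {u : ℝ → H} (hu : IsGlobalKirchhoffSolution A hA hpos m b ε u₀ u₁ u)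
    (hm : ContinuousOn m (Ici 0)) (hm_nonneg : ∀ σ ∈ Ici (0 : ℝ), 0 ≤ m σ)
    (hb : ContinuousOn b (Ici 0)) (hb_pos : ∀ t ∈ Ici (0 : ℝ), 0 < b t)
    (hb_int : MeasureTheory.IntegrableOn b (Ici 0)) (hε : 0 < ε)
    (henergy : 0 < ‖u₁‖ ^ 2 + ∫ σ in (0 : ℝ)..‖opVal (opSqrt A hA hpos) u₀‖ ^ 2, m σ) :
    ∃ c > 0, ∀ t ∈ Ici (0 : ℝ), c ≤ ε * ‖derivWithin u (Ici 0) t‖ ^ 2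
      + ∫ σ in (0 : ℝ)..‖opVal (opSqrt A hA hpos) (u t)‖ ^ 2, m σ := by
  set S := opSqrt A hA hpos
  have hS : IsNonnegSqrt A S := opSqrt_spec A hA hpos
  set v := derivWithin u (Ici 0)
  set w : ℝ → H := fun t => opVal S (u t)
  set M : ℝ → ℝ := fun x => ∫ σ in (0 : ℝ)..x, m (max σ 0)
  have hMd : ∀ x, HasDerivAt M (m (max x 0)) x := fun x =>
    (hm.continuous_comp_max.integral_hasStrictDerivAt 0 x).hasDerivAt
  have hMeq : ∀ t, M (‖w t‖ ^ 2) = ∫ σ in (0 : ℝ)..‖w t‖ ^ 2, m σ := fun t =>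
    intervalIntegral_comp_max m (sq_nonneg _)
  have hM0 : ∀ t, 0 ≤ M (‖w t‖ ^ 2) := fun t => by
    rw [hMeq]; exact intervalIntegral_nonneg_of_Ici hm_nonneg (sq_nonneg _)
  set E : ℝ → ℝ := fun t => ε * ‖v t‖ ^ 2 + M (‖w t‖ ^ 2)
  have hvC : ContDiffOn ℝ 1 v (Ici 0) := hu.contDiffOn.derivWithin (uniqueDiffOn_Ici 0) (by norm_num)
  have hwC : ContDiffOn ℝ (1 : ℕ) w (Ici 0) := hu.curve_sqrt.contDiffOn_opVal
  have hEc : ContinuousOn E (Ici 0) :=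
    (continuousOn_const.mul (hvC.continuousOn.norm.pow 2)).add
      ((continuous_iff_continuousAt.2 fun x => (hMd x).continuousAt).comp_continuousOn
        (hwC.continuousOn.norm.pow 2))
  have hE0 : 0 < E 0 := by
    have h1 : M (‖w 0‖ ^ 2) = ∫ σ in (0 : ℝ)..‖opVal S u₀‖ ^ 2, m σ := by
      rw [hMeq, ← hu.initial_value]
    have h2 := hM0 0
    change 0 < ε * ‖v 0‖ ^ 2 + M (‖w 0‖ ^ 2)
    rw [show v 0 = u₁ from hu.initial_velocity]
    rw [← h1] at henergy
    -- The hypothesis on the data carries no weight ε on |u₁|². If the potential term vanishes, then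
    -- |u₁|² > 0 and scaling by ε is harmless; otherwise the potential term alone is positive.
    rcases h2.eq_or_lt with h | h
    · rw [← h, add_zero] at henergy ⊢
      exact mul_pos hε henergy
    · positivity
  have hEd : ∀ t, 0 < t → HasDerivAt E (-(2 * b t * ‖v t‖ ^ 2)) t := by
    intro t ht
    have hn : Ici (0 : ℝ) ∈ 𝓝 t := Ici_mem_nhds ht
    have hud : HasDerivAt u (v t) t :=
      ((hu.contDiffOn.differentiableOn (by norm_num) t ht.le).hasDerivWithinAt).hasDerivAt hn
    have hvd : HasDerivAt v (derivWithin v (Ici 0) t) t :=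
      ((hvC.differentiableOn (by norm_num) t ht.le).hasDerivWithinAt).hasDerivAt hn
    obtain ⟨hvS, hwd⟩ := hu.curve_sqrt.hasDerivAt_opVal ht hud
    have hx := hS.inner_opVal (hu.curve_op.mem_domain ht.le) hvS
    have heq : ε • derivWithin v (Ici 0) t + b t • v t + m (‖w t‖ ^ 2) • opVal A (u t) = 0 :=
      hu.equation t ht.le
    -- Test the equation with u'. By `hx`, the term m⟨Au, u'⟩ is m⟨A^{1/2}u, A^{1/2}u'⟩, half the
    -- derivative of M(|A^{1/2}u|²).
    have hin := congrArg (fun z => inner ℝ z (v t)) heq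
    simp only [inner_add_left, real_inner_smul_left, inner_zero_left,
      real_inner_self_eq_norm_sq] at hin
    have hd := (hvd.norm_sq.const_mul ε).add ((hMd (‖w t‖ ^ 2)).comp t hwd.norm_sq)
    refine hd.congr_deriv ?_
    rw [max_eq_left (sq_nonneg _), hx, real_inner_comm]
    linear_combination 2 * hin
  -- The rate 2/ε comes from 2b|u'|² = (2/ε) b · ε|u'|² ≤ (2/ε) b E, where the nonnegative potential
  -- term is added on the right.
  refine ⟨E 0 * Real.exp (-(2 / ε * ∫ s in Ici (0 : ℝ), b s)),
    mul_pos hE0 (Real.exp_pos _), fun t ht => ?_⟩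
  rw [← hMeq]
  refine mul_exp_neg_integral_le (E := E) (by positivity) hEc hE0.le hEd hb
    (fun t ht => (hb_pos t ht).le) hb_int (fun t ht => ?_) ht
  have h1 : 2 / ε * b t * E t = 2 * b t * ‖v t‖ ^ 2 + 2 / ε * b t * M (‖w t‖ ^ 2) := by
    simp only [E]
    field_simp
  have h2 : 0 ≤ 2 / ε * b t * M (‖w t‖ ^ 2) :=
    mul_nonneg (mul_nonneg (by positivity) (hb_pos t ht.le).le) (hM0 t)
  linarith

theorem theorem4p1 {H : Type*} [NormedAddCommGroup H] [InnerProductSpace ℝ H] [CompleteSpace H]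
    (A : H →ₗ.[ℝ] H) (hA : IsSelfAdjoint A) (hpos : IsNonnegOp A)
    (m : ℝ → ℝ) (hm : ContinuousOn m (Ici 0)) (hm_nonneg : ∀ σ ∈ Ici (0 : ℝ), 0 ≤ m σ)
    (b : ℝ → ℝ) (hb : ContinuousOn b (Ici 0)) (hb_pos : ∀ t ∈ Ici (0 : ℝ), 0 < b t)
    (hb_int : MeasureTheory.IntegrableOn b (Ici 0))
    (u₀ u₁ : H) (hu₀ : u₀ ∈ A.domain) (hu₁ : u₁ ∈ (opSqrt A hA hpos).domain)
    (henergy : 0 < ‖u₁‖ ^ 2 + ∫ σ in (0 : ℝ)..‖opVal (opSqrt A hA hpos) u₀‖ ^ 2, m σ)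
    (ε : ℝ) (hε : 0 < ε) (u : ℝ → H)
    (hu : IsGlobalKirchhoffSolution A hA hpos m b ε u₀ u₁ u) :
    (0 : EReal) < liminf
      (fun t : ℝ => ((‖derivWithin u (Ici 0) t‖ ^ 2
        + ‖opVal (opSqrt A hA hpos) (u t)‖ ^ 2 : ℝ) : EReal)) atTop := by
  obtain ⟨c, hc, hE⟩ :=
    hu.exists_pos_le_energy hm hm_nonneg hb hb_pos hb_int hε henergy
  have hM : ContinuousAt (fun x => ∫ σ in (0 : ℝ)..x, m (max σ 0)) 0 :=
    (hm.continuous_comp_max.integral_hasStrictDerivAt 0 0).hasDerivAt.continuousAt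
  have hev : ∀ᶠ x in 𝓝 (0 : ℝ), ∫ σ in (0 : ℝ)..x, m (max σ 0) < c / 2 := by
    refine hM.eventually (gt_mem_nhds ?_)
    simpa using hc
  obtain ⟨η, hη, hball⟩ := Metric.eventually_nhds_iff.1 hev
  -- If the sum of the two squares drops below δ, then η forces the potential energy below c/2 and
  -- c/(2ε) forces the kinetic energy below c/2, contradicting the lower bound c.
  set δ := min η (c / (2 * ε))
  have hδ : 0 < δ := lt_min hη (by positivity)
  refine lt_of_lt_of_le (EReal.coe_pos.2 hδ) (le_liminf_of_le (by isBoundedDefault) ?_)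
  filter_upwards [eventually_ge_atTop (0 : ℝ)] with t ht
  rw [EReal.coe_le_coe_iff]
  by_contra! hlt
  have hv := sq_nonneg ‖derivWithin u (Ici 0) t‖
  have hw := sq_nonneg ‖opVal (opSqrt A hA hpos) (u t)‖
  have h1 := @hball (‖opVal (opSqrt A hA hpos) (u t)‖ ^ 2) (by
    rw [Real.dist_eq, sub_zero, abs_of_nonneg hw]
    linarith [min_le_left η (c / (2 * ε))])
  rw [intervalIntegral_comp_max m hw] at h1
  have h2 : ε * ‖derivWithin u (Ici 0) t‖ ^ 2 < c / 2 := by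
    have h3 : ‖derivWithin u (Ici 0) t‖ ^ 2 < c / (2 * ε) := by
      linarith [min_le_right η (c / (2 * ε))]
    rw [lt_div_iff₀ (by positivity)] at h3
    linarith
  linarith [hE t ht]
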